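/- Write $\mathbb{R}^+=(0,+\infty)$ and let $\lambda$ be Lebesgue measure on $\mathbb{R}^+$. Let $a_1>a_2>\dots\ge 0$ be either a finite sequence whose last element is $a_N=0$ (with $N\ge 1$; put $\mathcal J=\{0,\dots,N-1\}$), or an infinite sequence with $\lim_n a_n=0$ (put $\mathcal J=\{0,1,2,\dots\}$). Let $I_0=(a_1,+\infty)$ and $I_j=(a_{j+1},a_j)$ for $j\in\mathcal J$, $j\ge 1$. Let $T:\mathbb{R}^+\to\mathbb{R}^+$ satisfy the following assumptions. (B1) For every $j\in\mathcal J$, $T|_{I_j}$ is a bijection onto $\mathbb{R}^+$ and has an extension $\phi_j$ that is $C^2$ up to the boundary, defined on $[a_1,+\infty)$ if $j=0$, and on $[a_{j+1},a_j)$ or $(a_{j+1},a_j]$ if $j\ge 1$. (B2) There is $\Lambda>1$ such that $|\phi_j'|\ge\Lambda$ for all $j\in\mathcal J$ with $j\ge 1$. (B3) There is $K>0$ such that $|\phi_j''|/|\phi_j'|^2\le K$ for all $j\in\mathcal J$. (B4) The function $u(x)=x-\phi_0(x)$ is positive and convex on $[a_1,+\infty)$, $u(x)\to 0$ as $x\to+\infty$,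 and $u''$ is non-increasing. (B5') $T$ preserves a measure $\mu$ on $\mathbb{R}^+$ that is absolutely continuous with respect to $\lambda$, with a density $h=d\mu/d\lambda$ that is positive ($\lambda$-almost everywhere) and locally integrable on $(0,+\infty)$. Then $T$ is conservative and exact, with respect to $\lambda$ and, equivalently, with respect to $\mu$. That is, for $\nu=\lambda$ and for $\nu=\mu$: $T$ is measurable and non-singular ($\nu(A)=0$ implies $\nu(T^{-1}A)=0$); for every Borel set $A$ with $\nu(A)>0$ there are $x\in A$ and $m\ge 1$ with $T^m(x)\in A$; and every set $E$ in the tail $\sigma$-algebra $\bigcap_{n\ge 0}T^{-n}\mathcal B$, where $\mathcal B$ is the Borel $\sigma$-algebra of $\mathbb{R}^+$, satisfies $\nu(E)=0$ or $\nu(\mathbb{R}^+\setminus E)=0$. -/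

import Mathlib

open Set Filter Topology MeasureTheory

/-- The phase space `ℝ⁺ = (0, +∞)`, with the topology and the Borel σ-algebra that it carries
as a subtype of `ℝ`. -/
abbrev HalfLine : Type := Set.Ioi (0 : ℝ)

/-- Lebesgue measure on `ℝ⁺`. -/
noncomputable def lebHalfLine : Measure HalfLine :=
  (volume : Measure ℝ).comap Subtype.val

/-- The index set of the branches: `{0, …, N - 1}` if `N` is finite, all of `ℕ` if `N = ⊤`. -/
def branchIndex (N : ℕ∞) : Set ℕ := {j | (j : ℕ∞) < N}

/-- The sequence `a₁ > a₂ > … ≥ 0`: if `N` is finite it is `a₁ > … > a_N = 0`;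
if `N = ⊤` it is infinite, with limit `0`. The values `a 0`, and `a k` for `k > N`, are
never used. -/
structure IsPartitionSeq (N : ℕ∞) (a : ℕ → ℝ) : Prop where
  one_le : 1 ≤ N
  strict_anti : ∀ j ∈ branchIndex N, 1 ≤ j → a (j + 1) < a j
  last_eq_zero : ∀ n : ℕ, N = n → a n = 0
  tendsto_zero : N = ⊤ → Tendsto a atTop (𝓝 0)

/-- The partition intervals `I₀ = (a₁, +∞)` and `I_j = (a_{j+1}, a_j)` for `j ≥ 1`. -/
def partitionInterval (a : ℕ → ℝ) (j : ℕ) : Set ℝ :=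
  if j = 0 then Ioi (a 1) else Ioo (a (j + 1)) (a j)

/-- `D` is an admissible domain for the extension of the `j`-th branch: `[a₁, +∞)` if `j = 0`,
and one of `[a_{j+1}, a_j)`, `(a_{j+1}, a_j]` if `j ≥ 1`. -/
def IsBranchDomain (a : ℕ → ℝ) (j : ℕ) (D : Set ℝ) : Prop :=
  (j = 0 ∧ D = Ici (a 1)) ∨
    (j ≠ 0 ∧ (D = Ico (a (j + 1)) (a j) ∨ D = Ioc (a (j + 1)) (a j)))

/-- Each restriction `T|_{I_j}` is a bijection onto `ℝ⁺`, and has an extension `φ j` to the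
half-closed interval `D j`, which is `C²` up to the boundary. -/
structure HasFullBranches (N : ℕ∞) (a : ℕ → ℝ) (T : HalfLine → HalfLine)
    (D : ℕ → Set ℝ) (φ : ℕ → ℝ → ℝ) : Prop where
  bijOn : ∀ j ∈ branchIndex N,
    BijOn T {x : HalfLine | (x : ℝ) ∈ partitionInterval a j} univ
  domain : ∀ j ∈ branchIndex N, IsBranchDomain a j (D j)
  extends_map : ∀ j ∈ branchIndex N, ∀ x : HalfLine,
    (x : ℝ) ∈ partitionInterval a j → φ j x = T x
  contDiffOn : ∀ j ∈ branchIndex N, ContDiffOn ℝ 2 (φ j) (D j)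

/-- There is `Λ > 1` with `|φ_j'| ≥ Λ` for all `j ≥ 1`. -/
def IsExpandingOffZerothBranch (N : ℕ∞) (D : ℕ → Set ℝ) (φ : ℕ → ℝ → ℝ) : Prop :=
  ∃ Λ : ℝ, 1 < Λ ∧ ∀ j ∈ branchIndex N, 1 ≤ j → ∀ x ∈ D j,
    Λ ≤ |derivWithin (φ j) (D j) x|

/-- There is `K > 0` with `|φ_j''| / |φ_j'|² ≤ K` for all `j ≥ 0`. -/
def HasBoundedSecondDerivativeRatio (N : ℕ∞) (D : ℕ → Set ℝ) (φ : ℕ → ℝ → ℝ) : Prop :=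
  ∃ K : ℝ, 0 < K ∧ ∀ j ∈ branchIndex N, ∀ x ∈ D j,
    |iteratedDerivWithin 2 (φ j) (D j) x| / |derivWithin (φ j) (D j) x| ^ 2 ≤ K

/-- The function `u(x) = x - φ₀(x)` is positive and convex on `[a₁, +∞)`, it vanishes at `+∞`,
and `u''` is (weakly) decreasing. -/
structure IsNeutralAtInfinity (a : ℕ → ℝ) (φ₀ : ℝ → ℝ) : Prop where
  pos : ∀ x ∈ Ici (a 1), 0 < x - φ₀ x
  convexOn : ConvexOn ℝ (Ici (a 1)) (fun x => x - φ₀ x)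
  tendsto_zero : Tendsto (fun x => x - φ₀ x) atTop (𝓝 0)
  antitoneOn : AntitoneOn (iteratedDerivWithin 2 (fun x => x - φ₀ x) (Ici (a 1))) (Ici (a 1))

/-- The absolutely continuous measure `h dx` on `ℝ⁺`. -/
noncomputable def densityMeasure (h : HalfLine → ℝ) : Measure HalfLine :=
  lebHalfLine.withDensity (fun x => ENNReal.ofReal (h x))

/-- `T` preserves the measure `h dx`, where `h` is positive (almost everywhere) and locally
integrable on `ℝ⁺ = (0, +∞)`. -/
structure PreservesPositiveDensity (T : HalfLine → HalfLine) (h : HalfLine → ℝ) : Prop where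
  pos : ∀ᵐ x ∂lebHalfLine, 0 < h x
  locallyIntegrable : LocallyIntegrable h lebHalfLine
  measurePreserving : MeasurePreserving T (densityMeasure h) (densityMeasure h)

/-- The tail σ-algebra `⋂ₙ T⁻ⁿ 𝒜`. -/
abbrev tailSigmaAlgebra {X : Type*} [m : MeasurableSpace X] (T : X → X) : MeasurableSpace X :=
  ⨅ n : ℕ, m.comap (T^[n])

/-- `T` is exact with respect to `μ`: the tail σ-algebra contains only null sets and complements
of null sets. -/
def IsExactMap {X : Type*} [MeasurableSpace X] (T : X → X) (μ : Measure X) : Prop :=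
  ∀ s : Set X, MeasurableSet[tailSigmaAlgebra T] s → μ s = 0 ∨ μ sᶜ = 0

/-- A measure-preserving map is conservative as soon as almost every orbit visits some set of
finite measure infinitely often. -/
theorem conservative_of_frequently_visits {X : Type*} [MeasurableSpace X] {μ : Measure X}
    {T : X → X} (hT : MeasurePreserving T μ μ) {Y : Set X} (hY : MeasurableSet Y)
    (hYfin : μ Y ≠ ⊤) (hvisit : ∀ᵐ x ∂μ, ∃ᶠ n in atTop, T^[n] x ∈ Y) : Conservative T μ := by
  refine ⟨hT.quasiMeasurePreserving, fun s hs hs0 => ?_⟩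
  by_contra! hw
  have hmeas : ∀ k, Measurable (T^[k]) := fun k => hT.measurable.iterate k
  have hsum : ∀ n, ∑ k ∈ Finset.range (n + 1), μ (s ∩ T^[k] ⁻¹' Y) ≤ μ Y := by
    intro n
    have h1 : ∀ k ∈ Finset.range (n + 1), μ (s ∩ T^[k] ⁻¹' Y) =
        μ (T^[n - k] ⁻¹' s ∩ T^[n] ⁻¹' Y) := by
      intro k hk
      have hk : k ≤ n := by simpa [Nat.lt_succ_iff] using hk
      rw [← (hT.iterate (n - k)).measure_preimage
        (hs.inter (hmeas k hY)).nullMeasurableSet, preimage_inter, ← preimage_comp,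
        ← Function.iterate_add, Nat.add_sub_cancel' hk]
    rw [Finset.sum_congr rfl h1, ← measure_biUnion_finset]
    · rw [← (hT.iterate n).measure_preimage hY.nullMeasurableSet]
      exact measure_mono (iUnion₂_subset fun k _ => inter_subset_right)
    · have key : ∀ i j, i < j → j ≤ n → ∀ x, T^[n - i] x ∈ s → T^[n - j] x ∈ s → False := by
        intro i j hij hj x hi hj'
        refine hw _ hj' (j - i) (by omega) ?_
        rw [← Function.iterate_add_apply]
        convert hi using 3
        omega
      intro i hi j hj hij
      have hi : i ≤ n := by simpa [Nat.lt_succ_iff] using hi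
      have hj : j ≤ n := by simpa [Nat.lt_succ_iff] using hj
      refine Set.disjoint_left.2 fun x hx hx' => ?_
      rcases lt_or_gt_of_ne hij with h | h
      · exact key i j h hj x hx.1 hx'.1
      · exact key j i h hi x hx'.1 hx.1
    · exact fun k _ => (hmeas _ hs).inter (hmeas _ hY)
  have hfin : ∑' k, μ (s ∩ T^[k] ⁻¹' Y) ≠ ⊤ := by
    refine ne_top_of_le_ne_top hYfin ?_
    rw [ENNReal.tsum_eq_iSup_nat]
    refine iSup_le fun n => le_trans ?_ (hsum n)
    exact Finset.sum_le_sum_of_subset (Finset.range_mono (Nat.le_succ n))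
  have hnull : ∀ᵐ x ∂μ, x ∉ s := by
    filter_upwards [hvisit, ae_eventually_notMem hfin] with x hx hx' hxs
    obtain ⟨n, hn, hn'⟩ := (hx.and_eventually hx').exists
    exact hn' ⟨hxs, hn⟩
  exact hs0 (by simpa using measure_eq_zero_iff_ae_notMem.2 hnull)

/-- A differentiable function whose derivative is bounded below on an interval expands distances
there. -/
theorem mul_abs_sub_le_of_le_abs_deriv {f f' : ℝ → ℝ} {J : Set ℝ} (hJ : OrdConnected J)
    (hd : ∀ y ∈ J, HasDerivAt f (f' y) y) {c : ℝ} (hlow : ∀ y ∈ J, c ≤ |f' y|)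
    {y z : ℝ} (hy : y ∈ J) (hz : z ∈ J) : c * |y - z| ≤ |f y - f z| := by
  wlog hyz : z < y generalizing y z
  · rcases (not_lt.1 hyz).eq_or_lt with rfl | h
    · simp
    · rw [abs_sub_comm y, abs_sub_comm (f y)]
      exact this hz hy h
  have hsub : Icc z y ⊆ J := hJ.out hz hy
  obtain ⟨w, hw, hw'⟩ := exists_hasDerivAt_eq_slope f f' hyz
    (fun t ht => (hd t (hsub ht)).continuousAt.continuousWithinAt)
    (fun t ht => hd t (hsub (Ioo_subset_Icc_self ht)))
  have h0 : 0 < y - z := sub_pos.2 hyz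
  have h1 : f y - f z = f' w * (y - z) := by rw [hw']; field_simp
  rw [h1, abs_mul]
  exact mul_le_mul_of_nonneg_right (hlow w (hsub (Ioo_subset_Icc_self hw))) (abs_nonneg _)

theorem abs_sub_le_of_abs_deriv_le {f f' : ℝ → ℝ} {J : Set ℝ} (hJ : OrdConnected J)
    (hd : ∀ y ∈ J, HasDerivAt f (f' y) y) {c : ℝ} (hup : ∀ y ∈ J, |f' y| ≤ c)
    {y z : ℝ} (hy : y ∈ J) (hz : z ∈ J) : |f y - f z| ≤ c * |y - z| :=
  hJ.convex.norm_image_sub_le_of_norm_hasDerivWithin_le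
    (fun t ht => (hd t ht).hasDerivWithinAt) hup hz hy

theorem volume_inter_preimage_le {f f' : ℝ → ℝ} {J : Set ℝ} (hJ : OrdConnected J)
    (hd : ∀ y ∈ J, HasDerivAt f (f' y) y) {c : ℝ} (hc : 0 < c) (hlow : ∀ y ∈ J, c ≤ |f' y|)
    (B : Set ℝ) : volume (J ∩ f ⁻¹' B) ≤ ENNReal.ofReal c⁻¹ * volume B := by
  have hanti : AntilipschitzWith (Real.toNNReal c⁻¹) (fun y : J => f y) := by
    refine AntilipschitzWith.of_le_mul_dist fun y z => ?_
    rw [Real.coe_toNNReal _ (inv_nonneg.2 hc.le), Subtype.dist_eq, Real.dist_eq, Real.dist_eq,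
      le_inv_mul_iff₀ hc]
    exact mul_abs_sub_le_of_le_abs_deriv hJ hd hlow y.2 z.2
  have h := hanti.hausdorffMeasure_preimage_le zero_le_one B
  have himg : J ∩ f ⁻¹' B = Subtype.val '' ((fun y : J => f y) ⁻¹' B) := by
    ext t; simp [and_comm]
  rw [← hausdorffMeasure_real, himg,
    isometry_subtype_coe.hausdorffMeasure_image (Or.inl zero_le_one)]
  simpa [ENNReal.ofReal] using h

/-- Lebesgue density theorem, on centred intervals of the line. -/
theorem ae_density {A : Set ℝ} {ε : ℝ} (hε : 0 < ε) :
    ∀ᵐ x ∂volume, MeasurableSet A → x ∈ A → ∃ r₀ > 0, ∀ r, 0 < r → r < r₀ →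
      volume (Metric.closedBall x r \ A) ≤ ENNReal.ofReal (ε * r) := by
  by_cases hA : MeasurableSet A
  swap
  · exact Eventually.of_forall fun x h => absurd h hA
  filter_upwards [Besicovitch.ae_tendsto_measure_inter_div_of_measurableSet
    (volume : Measure ℝ) hA.compl] with x hx _ hxA
  rw [indicator_of_notMem (by simpa using hxA)] at hx
  have h2 : (0 : ENNReal) < ENNReal.ofReal (ε / 2) := by simpa using hε
  obtain ⟨r₀, hr₀, H⟩ := mem_nhdsGT_iff_exists_Ioo_subset.1 (hx (Iio_mem_nhds h2))
  refine ⟨r₀, hr₀, fun r hr hr' => ?_⟩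
  have h3 : volume (Aᶜ ∩ Metric.closedBall x r) / volume (Metric.closedBall x r) <
      ENNReal.ofReal (ε / 2) := H ⟨hr, hr'⟩
  have hv : volume (Metric.closedBall x r) = ENNReal.ofReal (2 * r) := Real.volume_closedBall x r
  rw [hv, ENNReal.div_lt_iff (Or.inl (by simpa using hr)) (Or.inl ENNReal.ofReal_ne_top),
    ← ENNReal.ofReal_mul (by positivity)] at h3
  rw [sdiff_eq, inter_comm, show ε * r = ε / 2 * (2 * r) by ring]
  exact h3.le

/-- `ψ`, with derivative `ψ'`, is the inverse of the full branch of `T` over `I`, and the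
logarithm of `|ψ'|` is `K`-Lipschitz. -/
structure IsInverseBranch (T : HalfLine → HalfLine) (I : Set ℝ) (K : ℝ) (ψ ψ' : ℝ → ℝ) :
    Prop where
  mem : ∀ y, 0 < y → ψ y ∈ I
  pos : ∀ y, 0 < y → 0 < ψ y
  map_eq : ∀ x y : HalfLine, (x : ℝ) = ψ y → T x = y
  apply_map : ∀ x : HalfLine, (x : ℝ) ∈ I → ψ (T x) = x
  hasDerivAt : ∀ y, 0 < y → HasDerivAt ψ (ψ' y) y
  ne_zero : ∀ y, 0 < y → ψ' y ≠ 0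
  distortion : ∀ y z, 0 < y → 0 < z →
    |Real.log (ψ' y) - Real.log (ψ' z)| ≤ K * |y - z|

theorem exists_isInverseBranch {T : HalfLine → HalfLine} {I : Set ℝ} {K : ℝ} {g : ℝ → ℝ}
    (hI : IsOpen I) (hT : BijOn T {x : HalfLine | (x : ℝ) ∈ I} univ)
    (hg : ∀ x : HalfLine, (x : ℝ) ∈ I → g x = T x)
    (hC : ∀ x ∈ I, ContDiffAt ℝ 2 g x) (hne : ∀ x ∈ I, deriv g x ≠ 0)
    (hK : ∀ x ∈ I, |deriv (deriv g) x| / |deriv g x| ^ 2 ≤ K) :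
    ∃ ψ ψ' : ℝ → ℝ, IsInverseBranch T I K ψ ψ' ∧ ∀ y, 0 < y → ψ' y = (deriv g (ψ y))⁻¹ := by
  have hsurj : ∀ y : HalfLine, ∃ x : HalfLine, (x : ℝ) ∈ I ∧ T x = y := fun y =>
    hT.surjOn (mem_univ y)
  choose S hSI hTS using hsurj
  let ψ : ℝ → ℝ := fun y => if hy : 0 < y then (S ⟨y, hy⟩ : ℝ) else 0
  have hψ : ∀ y : HalfLine, ψ y = S y := fun y => dif_pos y.2
  have hψI : ∀ y, 0 < y → ψ y ∈ I := fun y hy => by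
    rw [hψ ⟨y, hy⟩]; exact hSI _
  have hψ0 : ∀ y, 0 < y → 0 < ψ y := fun y hy => by
    rw [hψ ⟨y, hy⟩]; exact (S _).2
  have hleft : ∀ x : HalfLine, (x : ℝ) ∈ I → ψ (T x) = x := fun x hx => by
    rw [hψ, hT.injOn (hSI (T x)) hx (hTS (T x))]
  have hgψ : ∀ y, 0 < y → g (ψ y) = y := fun y hy => by
    rw [hψ ⟨y, hy⟩, hg _ (hSI _), hTS]
  have hderiv : ∀ y, 0 < y → HasDerivAt ψ (deriv g (ψ y))⁻¹ y := by
    intro y hy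
    have hstrict : HasStrictDerivAt g (deriv g (ψ y)) (ψ y) :=
      (hC _ (hψI y hy)).hasStrictDerivAt (by norm_num)
    have hev : ∀ᶠ x in 𝓝 (ψ y), ψ (g x) = x := by
      filter_upwards [hI.mem_nhds (hψI y hy), Ioi_mem_nhds (hψ0 y hy)] with x hx hx0
      have h1 := hleft ⟨x, hx0⟩ hx
      rwa [← hg ⟨x, hx0⟩ hx] at h1
    have h2 := (hstrict.to_local_left_inverse (hne _ (hψI y hy)) hev).hasDerivAt
    rwa [hgψ y hy] at h2
  refine ⟨ψ, fun y => (deriv g (ψ y))⁻¹, ⟨hψI, hψ0, ?_, hleft, hderiv,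
    fun y hy => inv_ne_zero (hne _ (hψI y hy)), ?_⟩, fun y _ => rfl⟩
  · intro x y hxy
    rw [hψ] at hxy
    rw [Subtype.ext hxy, hTS]
  · intro y z hy hz
    have hlog : ∀ t ∈ Ioi (0 : ℝ), HasDerivAt (fun t => Real.log (deriv g (ψ t))⁻¹)
        (-(deriv (deriv g) (ψ t) * (deriv g (ψ t))⁻¹ / deriv g (ψ t))) t := by
      intro t ht
      have h1 : ContDiffAt ℝ 1 (deriv g) (ψ t) := by
        have := hC _ (hψI t ht)
        exact this.derivWithin (m := 1) (by norm_num)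
      have h2 : HasDerivAt (deriv g) (deriv (deriv g) (ψ t)) (ψ t) :=
        (h1.differentiableAt (by norm_num)).hasDerivAt
      have h3 := ((h2.comp t (hderiv t ht)).log (hne _ (hψI t ht))).neg
      simp only [Real.log_inv]
      exact h3
    refine abs_sub_le_of_abs_deriv_le ordConnected_Ioi hlog (fun t ht => ?_) hy hz
    refine le_of_eq_of_le ?_ (hK _ (hψI t ht))
    rw [abs_neg, abs_div, abs_mul, abs_inv]
    have := abs_pos.2 (hne _ (hψI t ht))
    field_simp

namespace IsInverseBranch

variable {T : HalfLine → HalfLine} {I : Set ℝ} {K : ℝ} {ψ ψ' : ℝ → ℝ}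

theorem abs_sub_le (h : IsInverseBranch T I K ψ ψ') {c : ℝ} (hc : ∀ y, 0 < y → |ψ' y| ≤ c)
    {y z : ℝ} (hy : 0 < y) (hz : 0 < z) : |ψ y - ψ z| ≤ c * |y - z| :=
  abs_sub_le_of_abs_deriv_le ordConnected_Ioi (J := Ioi 0) h.hasDerivAt hc hy hz

/-- On a bounded interval the derivative of an inverse branch is bounded away from `0`. -/
theorem exists_pos_le (h : IsInverseBranch T I K ψ ψ') (hK : 0 ≤ K) {M : ℝ} (hM : 0 < M) :
    ∃ c > 0, ∀ y ∈ Ioo 0 M, c ≤ |ψ' y| := by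
  have hpos := abs_pos.2 (h.ne_zero M hM)
  refine ⟨|ψ' M| * Real.exp (-(K * M)), by positivity, fun y hy => ?_⟩
  have h1 := h.distortion M y hM hy.1
  have h2 : |M - y| ≤ M := by rw [abs_of_pos (by linarith [hy.2])]; linarith [hy.1]
  have h3 := (abs_le.1 (h1.trans (mul_le_mul_of_nonneg_left h2 hK))).2
  rw [← Real.log_abs (ψ' M), ← Real.log_abs (ψ' y)] at h3
  have hy0 := abs_pos.2 (h.ne_zero y hy.1)
  rw [← Real.exp_log hpos, ← Real.exp_log hy0, ← Real.exp_add, Real.exp_le_exp]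
  linarith

end IsInverseBranch

/-- The inverse `ψ` of the branch `x ↦ x - u x` over `(a, +∞)`, where `u` is positive, convex and
non-increasing, with concave derivative `v`. -/
structure IsNeutralInverseBranch (T : HalfLine → HalfLine) (a K : ℝ) (u v ψ ψ' : ℝ → ℝ) : Prop
    extends IsInverseBranch T (Ioi a) K ψ ψ' where
  a_pos : 0 < a
  K_nonneg : 0 ≤ K
  eq_add : ∀ y, 0 < y → ψ y = y + u (ψ y)
  deriv_eq : ∀ y, 0 < y → ψ' y = (1 - v (ψ y))⁻¹
  u_pos : ∀ x, a < x → 0 < u x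
  u_convex : ConvexOn ℝ (Ioi a) u
  u_anti : AntitoneOn u (Ioi a)
  v_nonpos : ∀ x, a < x → v x ≤ 0
  v_mono : MonotoneOn v (Ioi a)
  v_concave : ConcaveOn ℝ (Ioi a) v

/-- The pair `P ≤ Q` lies in a run along the neutral branch that started with a pair of points at
distance `e`; `s` is the distortion accumulated so far, starting from points at distance `d`. -/
def NeutralRun (a K C w V : ℝ) (u v ψ : ℝ → ℝ) (d s P Q : ℝ) : Prop :=
  ∃ e, 0 ≤ e ∧ a < P ∧ P ≤ Q ∧ Q ≤ ψ P ∧ Q - P ≤ e ∧ (Q - P) * w ≤ e * u (ψ P) ∧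
    |s| + C * e ≤ C * d + e * K + e / w * (v P + V)

/-- Invariant controlling the distortion `s` of a composition of inverse branches that takes points
at distance `d` to `p` and `q`. -/
def DistortionBound (a K C w V : ℝ) (u v ψ : ℝ → ℝ) (d s p q : ℝ) : Prop :=
  (p < a ∧ q < a ∧ |s| + C * |p - q| ≤ C * d) ∨
    NeutralRun a K C w V u v ψ d s p q ∨ NeutralRun a K C w V u v ψ d s q p

theorem NeutralRun.abs_le {a K C w V : ℝ} {u v ψ : ℝ → ℝ} {d s P Q : ℝ} (hw : 0 < w)
    (hv : ∀ x, a < x → v x ≤ 0) (hC : K + V / w ≤ C)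
    (h : NeutralRun a K C w V u v ψ d s P Q) : |s| ≤ C * d := by
  obtain ⟨e, he, hP, -, -, -, -, h⟩ := h
  have h1 : e / w * (v P + V) ≤ e / w * V :=
    mul_le_mul_of_nonneg_left (by linarith [hv P hP]) (by positivity)
  have h2 : e / w * V = e * (V / w) := by ring
  have h3 := mul_le_mul_of_nonneg_left hC he
  linarith

theorem DistortionBound.abs_le {a K C w V : ℝ} {u v ψ : ℝ → ℝ} {d s p q : ℝ} (hw : 0 < w)
    (hv : ∀ x, a < x → v x ≤ 0) (hC0 : 0 ≤ C) (hC : K + V / w ≤ C)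
    (h : DistortionBound a K C w V u v ψ d s p q) : |s| ≤ C * d := by
  rcases h with ⟨-, -, h⟩ | h | h
  · have := mul_nonneg hC0 (abs_nonneg (p - q))
    linarith
  · exact h.abs_le hw hv hC
  · exact h.abs_le hw hv hC

/-- Prepending an expanding branch preserves the distortion invariant. -/
theorem DistortionBound.expanding {a K C w V κ : ℝ} {u v ψ : ℝ → ℝ} {d s p q t p' q' : ℝ}
    (hw : 0 < w) (hv : ∀ x, a < x → v x ≤ 0) (hC0 : 0 ≤ C) (hK : 0 ≤ K) (hV : 0 ≤ V)
    (hκ : 0 ≤ κ)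
    (hC : 2 * K + V / w + C * κ ≤ C) (h : DistortionBound a K C w V u v ψ d s p q)
    (hp : p' < a) (hq : q' < a) (ht : |t| ≤ K * |p - q|) (hpq : |p' - q'| ≤ κ * |p - q|) :
    DistortionBound a K C w V u v ψ d (t + s) p' q' := by
  refine Or.inl ⟨hp, hq, ?_⟩
  have hVw : 0 ≤ V / w := by positivity
  have key : ∃ e, 0 ≤ e ∧ |p - q| ≤ e ∧ |s| + C * e ≤ C * d + e * (K + V / w) := by
    have aux : ∀ P Q, NeutralRun a K C w V u v ψ d s P Q →
        ∃ e, 0 ≤ e ∧ |P - Q| ≤ e ∧ |s| + C * e ≤ C * d + e * (K + V / w) := by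
      rintro P Q ⟨e, he, hP, hPQ, -, h1, -, h2⟩
      refine ⟨e, he, by rw [abs_sub_comm, abs_of_nonneg (by linarith)]; exact h1, ?_⟩
      have h3 : e / w * (v P + V) ≤ e / w * V :=
        mul_le_mul_of_nonneg_left (by linarith [hv P hP]) (by positivity)
      have h4 : e / w * V = e * (V / w) := by ring
      linarith
    rcases h with ⟨-, -, h⟩ | h | h
    · refine ⟨|p - q|, abs_nonneg _, le_rfl, ?_⟩
      have : 0 ≤ |p - q| * (K + V / w) := by positivity
      linarith
    · exact aux p q h
    · obtain ⟨e, h0, h1, h2⟩ := aux q p h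
      exact ⟨e, h0, by rwa [abs_sub_comm], h2⟩
  obtain ⟨e, he, h1, h2⟩ := key
  have h3 : |t| ≤ K * e := ht.trans (mul_le_mul_of_nonneg_left h1 hK)
  have h4 : |p' - q'| ≤ κ * e := hpq.trans (mul_le_mul_of_nonneg_left h1 hκ)
  have h5 := mul_le_mul_of_nonneg_left h4 hC0
  have h6 := mul_le_mul_of_nonneg_right hC he
  have h7 := abs_add_le t s
  nlinarith

namespace IsNeutralInverseBranch

variable {T : HalfLine → HalfLine} {a K : ℝ} {u v ψ ψ' : ℝ → ℝ}

theorem lt_apply (h : IsNeutralInverseBranch T a K u v ψ ψ') {p : ℝ} (hp : 0 < p) : a < ψ p :=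
  h.mem p hp

theorem mono (h : IsNeutralInverseBranch T a K u v ψ ψ') {p q : ℝ} (hp : 0 < p) (hpq : p ≤ q) :
    ψ p ≤ ψ q := by
  have hq := hp.trans_le hpq
  by_contra! hlt
  have h1 := h.u_anti (h.mem q hq) (h.mem p hp) hlt.le
  linarith [h.eq_add p hp, h.eq_add q hq]

theorem sub_le (h : IsNeutralInverseBranch T a K u v ψ ψ') {p q : ℝ} (hp : 0 < p) (hpq : p ≤ q) :
    ψ q - ψ p ≤ q - p := by
  have hq := hp.trans_le hpq
  have h1 := h.u_anti (h.mem p hp) (h.mem q hq) (h.mono hp hpq)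
  linarith [h.eq_add p hp, h.eq_add q hq]

theorem le_apply (h : IsNeutralInverseBranch T a K u v ψ ψ') {p : ℝ} (hp : 0 < p) : p ≤ ψ p := by
  linarith [h.eq_add p hp, h.u_pos _ (h.mem p hp)]

theorem deriv_pos (h : IsNeutralInverseBranch T a K u v ψ ψ') {p : ℝ} (hp : 0 < p) : 0 < ψ' p := by
  rw [h.deriv_eq p hp, inv_pos]
  linarith [h.v_nonpos _ (h.mem p hp)]

theorem abs_deriv_le_one (h : IsNeutralInverseBranch T a K u v ψ ψ') {p : ℝ} (hp : 0 < p) :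
    |ψ' p| ≤ 1 := by
  rw [abs_of_pos (h.deriv_pos hp), h.deriv_eq p hp]
  exact inv_le_one_of_one_le₀ (by linarith [h.v_nonpos _ (h.mem p hp)])

/-- The length of a short interval contracts along the neutral branch like `u`. -/
theorem sub_mul_le (h : IsNeutralInverseBranch T a K u v ψ ψ') {p q : ℝ} (hp : 0 < p)
    (hpq : p ≤ q) (hq : q ≤ ψ p) :
    (ψ q - ψ p) * u (ψ p) ≤ (q - p) * u (ψ (ψ p)) := by
  have hq0 := hp.trans_le hpq
  have hP0 := h.pos p hp
  have hPQ := h.mono hp hpq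
  have hQR := h.mono hq0 hq
  have e1 := h.eq_add p hp
  have e2 := h.eq_add q hq0
  have e3 := h.eq_add (ψ p) hP0
  have hR := h.u_pos _ (h.mem _ hP0)
  rcases hPQ.eq_or_lt with hPQ' | hPQ'
  · rw [← hPQ', sub_self, zero_mul]
    exact mul_nonneg (by linarith) hR.le
  rcases hQR.eq_or_lt with hQR' | hQR'
  · rw [← hQR'] at e3 hR ⊢
    rw [hQR'] at e3
    have : ψ q - ψ p = u (ψ q) := by rw [hQR'] at *; linarith
    rw [this, mul_comm]
    refine mul_le_mul_of_nonneg_right ?_ hR.le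
    linarith
  · have hs := h.u_convex.slope_mono_adjacent (h.mem p hp) (h.mem _ hP0) hPQ' hQR'
    rw [div_le_div_iff₀ (by linarith) (by linarith)] at hs
    nlinarith

theorem abs_log_sub_le (h : IsNeutralInverseBranch T a K u v ψ ψ') {p q : ℝ} (hp : 0 < p)
    (hpq : p ≤ q) : |Real.log (ψ' p) - Real.log (ψ' q)| ≤ v (ψ q) - v (ψ p) := by
  have hq := hp.trans_le hpq
  rw [h.deriv_eq p hp, h.deriv_eq q hq, Real.log_inv, Real.log_inv]
  have h1 := h.v_nonpos _ (h.mem p hp)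
  have h2 := h.v_nonpos _ (h.mem q hq)
  have h3 := h.v_mono (h.mem p hp) (h.mem q hq) (h.mono hp hpq)
  have h4 : Real.log (1 - v (ψ q)) ≤ Real.log (1 - v (ψ p)) :=
    Real.log_le_log (by linarith) (by linarith)
  rw [abs_sub_comm, neg_sub_neg, abs_of_nonneg (by linarith), ← Real.log_div (by linarith)
    (by linarith)]
  refine (Real.log_le_sub_one_of_pos (div_pos (by linarith) (by linarith))).trans ?_
  rw [div_sub_one (by linarith), div_le_iff₀ (by linarith)]
  nlinarith

/-- Entering the neutral branch. -/
theorem neutralRun_of_lt (h : IsNeutralInverseBranch T a K u v ψ ψ') {C V d s p q t : ℝ}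
    (hp : 0 < p) (hpq : p ≤ q) (hq : q < a) (hV : -v (ψ p) ≤ V)
    (hs : |s| + C * |p - q| ≤ C * d) (ht : |t| ≤ K * |p - q|) :
    NeutralRun a K C (u (ψ a)) V u v ψ d (t + s) (ψ p) (ψ q) := by
  have hP := h.lt_apply hp
  have hw := h.u_pos _ (h.lt_apply h.a_pos)
  have hq0 := hp.trans_le hpq
  rw [abs_sub_comm p q, abs_of_nonneg (sub_nonneg.2 hpq)] at hs ht
  refine ⟨q - p, by linarith, hP, h.mono hp hpq, h.mono hq0 (by linarith), h.sub_le hp hpq,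
    ?_, ?_⟩
  · refine le_trans ?_ (h.sub_mul_le hp hpq (by linarith))
    refine mul_le_mul_of_nonneg_left ?_ (by linarith [h.mono hp hpq])
    exact h.u_anti hP (h.lt_apply h.a_pos) (h.mono hp (by linarith))
  · have h1 : 0 ≤ (q - p) / u (ψ a) * (v (ψ p) + V) :=
      mul_nonneg (div_nonneg (by linarith) hw.le) (by linarith)
    have h2 := abs_add_le t s
    linarith

/-- Going on along the neutral branch. -/
theorem neutralRun_step (h : IsNeutralInverseBranch T a K u v ψ ψ') {C V d s p q t : ℝ}
    (hr : NeutralRun a K C (u (ψ a)) V u v ψ d s p q)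
    (ht : |t| ≤ v (ψ q) - v (ψ p)) :
    NeutralRun a K C (u (ψ a)) V u v ψ d (t + s) (ψ p) (ψ q) := by
  obtain ⟨e, he, hap, hpq, hqp, h1, h2, h3⟩ := hr
  have hp : 0 < p := h.a_pos.trans hap
  have hq0 := hp.trans_le hpq
  have hw := h.u_pos _ (h.lt_apply h.a_pos)
  set w := u (ψ a)
  have hP := h.lt_apply hp
  have hQ := h.lt_apply hq0
  have hPQ := h.mono hp hpq
  have hUP := h.u_pos _ hP
  have hUR := h.u_pos _ (h.lt_apply (h.pos p hp))
  have hlen : (ψ q - ψ p) * w ≤ e * u (ψ (ψ p)) := by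
    have h4 := h.sub_mul_le hp hpq hqp
    refine le_of_mul_le_mul_right ?_ hUP
    calc (ψ q - ψ p) * w * u (ψ p) = (ψ q - ψ p) * u (ψ p) * w := by ring
      _ ≤ (q - p) * u (ψ (ψ p)) * w := mul_le_mul_of_nonneg_right h4 hw.le
      _ = (q - p) * w * u (ψ (ψ p)) := by ring
      _ ≤ e * u (ψ p) * u (ψ (ψ p)) := mul_le_mul_of_nonneg_right h2 hUR.le
      _ = _ := by ring
  refine ⟨e, he, hP, hPQ, h.mono hq0 hqp, (h.sub_le hp hpq).trans h1, hlen, ?_⟩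
  have hpP : ψ p - p = u (ψ p) := by linarith [h.eq_add p hp]
  have hv : v (ψ q) - v (ψ p) ≤ e / w * (v (ψ p) - v p) := by
    have hvp : 0 ≤ v (ψ p) - v p :=
      sub_nonneg.2 (h.v_mono hap hP (h.le_apply hp))
    rcases hPQ.eq_or_lt with hPQ' | hPQ'
    · rw [← hPQ', sub_self]
      positivity
    · have hs := h.v_concave.slope_anti_adjacent (show p ∈ Ioi a from hap) hQ
        (show p < ψ p by linarith) hPQ'
      rw [hpP, div_le_div_iff₀ (by linarith) hUP] at hs
      have h5 : u (ψ (ψ p)) ≤ u (ψ p) :=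
        h.u_anti hP (h.lt_apply (h.pos p hp)) (h.le_apply (h.pos p hp))
      have h6 : ψ q - ψ p ≤ e / w * u (ψ p) := by
        rw [div_mul_eq_mul_div, le_div_iff₀ hw]
        exact hlen.trans (mul_le_mul_of_nonneg_left h5 he)
      refine le_of_mul_le_mul_right (hs.trans ?_) hUP
      calc (v (ψ p) - v p) * (ψ q - ψ p) ≤ (v (ψ p) - v p) * (e / w * u (ψ p)) :=
            mul_le_mul_of_nonneg_left h6 hvp
        _ = _ := by ring
  have h7 := abs_add_le t s
  have h8 : e / w * (v (ψ p) + V) = e / w * (v p + V) + e / w * (v (ψ p) - v p) := by ring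
  linarith

/-- Prepending the neutral branch preserves the distortion invariant. -/
theorem distortionBound (h : IsNeutralInverseBranch T a K u v ψ ψ') {C V d s p q : ℝ}
    (hV : ∀ y ∈ Ioo 0 a, -v (ψ y) ≤ V) (hp : 0 < p) (hq : 0 < q)
    (hr : DistortionBound a K C (u (ψ a)) V u v ψ d s p q) :
    DistortionBound a K C (u (ψ a)) V u v ψ d (Real.log (ψ' p) - Real.log (ψ' q) + s)
      (ψ p) (ψ q) := by
  have hd := h.distortion p q hp hq
  rcases hr with ⟨hpa, hqa, hs⟩ | hr | hr
  · rcases le_total p q with hpq | hpq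
    · exact Or.inr (Or.inl (h.neutralRun_of_lt hp hpq hqa (hV p ⟨hp, hpa⟩) hs hd))
    · rw [abs_sub_comm p q] at hs hd
      exact Or.inr (Or.inr (h.neutralRun_of_lt hq hpq hpa (hV q ⟨hq, hqa⟩) hs hd))
  · have hpq : p ≤ q := by obtain ⟨e, -, -, h, -⟩ := hr; exact h
    exact Or.inr (Or.inl (h.neutralRun_step hr (h.abs_log_sub_le hp hpq)))
  · have hpq : q ≤ p := by obtain ⟨e, -, -, h, -⟩ := hr; exact h
    refine Or.inr (Or.inr (h.neutralRun_step hr ?_))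
    rw [abs_sub_comm]
    exact h.abs_log_sub_le hq hpq

theorem exists_neg_deriv_le (h : IsNeutralInverseBranch T a K u v ψ ψ') :
    ∃ V, 0 ≤ V ∧ ∀ y ∈ Ioo 0 a, -v (ψ y) ≤ V := by
  obtain ⟨c, hc, hc'⟩ := h.exists_pos_le h.K_nonneg h.a_pos
  refine ⟨c⁻¹, by positivity, fun y hy => ?_⟩
  have h1 := hc' y hy
  rw [abs_of_pos (h.deriv_pos hy.1), h.deriv_eq y hy.1] at h1
  have h2 := h.v_nonpos _ (h.mem y hy.1)
  have h3 := (le_inv_comm₀ hc (by linarith)).1 h1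
  linarith

end IsNeutralInverseBranch

/-- `χ`, with derivative `χ'`, is an inverse of `T^[n]` over `(0, a)`, it contracts by a factor `δ`,
and its distortion satisfies the bound `R`. -/
structure IsPullback (T : HalfLine → HalfLine) (a δ : ℝ) (R : ℝ → ℝ → ℝ → ℝ → Prop) (n : ℕ)
    (χ χ' : ℝ → ℝ) : Prop where
  pos : ∀ y ∈ Ioo 0 a, 0 < χ y
  hasDerivAt : ∀ y ∈ Ioo 0 a, HasDerivAt χ (χ' y) y
  ne_zero : ∀ y ∈ Ioo 0 a, χ' y ≠ 0
  abs_le : ∀ y ∈ Ioo 0 a, |χ' y| ≤ δ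
  map_eq : ∀ x y : HalfLine, (y : ℝ) < a → (x : ℝ) = χ y → T^[n] x = y
  bound : ∀ y ∈ Ioo 0 a, ∀ z ∈ Ioo 0 a,
    R |y - z| (Real.log (χ' y) - Real.log (χ' z)) (χ y) (χ z)

theorem IsPullback.prepend {T : HalfLine → HalfLine} {a δ K c : ℝ} {R : ℝ → ℝ → ℝ → ℝ → Prop}
    {n : ℕ} {χ χ' : ℝ → ℝ} (h : IsPullback T a δ R n χ χ') {I : Set ℝ} {ψ ψ' : ℝ → ℝ}
    (hψ : IsInverseBranch T I K ψ ψ') (hc : 0 ≤ c) (hψc : ∀ y, 0 < y → |ψ' y| ≤ c)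
    (hR : ∀ d s p q, 0 < p → 0 < q → R d s p q →
      R d (Real.log (ψ' p) - Real.log (ψ' q) + s) (ψ p) (ψ q)) :
    IsPullback T a (c * δ) R (n + 1) (ψ ∘ χ) (fun y => ψ' (χ y) * χ' y) where
  pos y hy := hψ.pos _ (h.pos y hy)
  hasDerivAt y hy := (hψ.hasDerivAt _ (h.pos y hy)).comp y (h.hasDerivAt y hy)
  ne_zero y hy := mul_ne_zero (hψ.ne_zero _ (h.pos y hy)) (h.ne_zero y hy)
  abs_le y hy := by
    rw [abs_mul]
    exact mul_le_mul (hψc _ (h.pos y hy)) (h.abs_le y hy) (abs_nonneg _) hc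
  map_eq x y hy hxy := by
    have hpos := h.pos y ⟨y.2, hy⟩
    rw [Function.iterate_succ_apply, hψ.map_eq x ⟨χ y, hpos⟩ hxy]
    exact h.map_eq _ y hy rfl
  bound y hy z hz := by
    rw [Real.log_mul (hψ.ne_zero _ (h.pos y hy)) (h.ne_zero y hy),
      Real.log_mul (hψ.ne_zero _ (h.pos z hz)) (h.ne_zero z hz), add_sub_add_comm]
    exact hR _ _ _ _ (h.pos y hy) (h.pos z hz) (h.bound y hy z hz)

/-- A map of the half-line with a neutral branch over `(a, +∞)`, and such that every point of
`(0, a)` outside a countable set lies in the domain of a branch with inverse contracting by `κ`. -/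
structure IsNeutralExpandingMap (T : HalfLine → HalfLine) (a K κ : ℝ) (P : Set ℝ)
    (u v ψ ψ' : ℝ → ℝ) : Prop extends IsNeutralInverseBranch T a K u v ψ ψ' where
  κ_pos : 0 < κ
  κ_lt_one : κ < 1
  countable : P.Countable
  mem_exceptional : a ∈ P
  expanding : ∀ x : HalfLine, (x : ℝ) ∉ P → (x : ℝ) < a →
    ∃ (I : Set ℝ) (χ χ' : ℝ → ℝ), I ⊆ Iio a ∧ (x : ℝ) ∈ I ∧ IsInverseBranch T I K χ χ' ∧
      ∀ y, 0 < y → |χ' y| ≤ κ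

namespace IsNeutralExpandingMap

variable {T : HalfLine → HalfLine} {a K κ : ℝ} {P : Set ℝ} {u v ψ ψ' : ℝ → ℝ}

theorem eq_map_add (h : IsNeutralExpandingMap T a K κ P u v ψ ψ') {x : HalfLine}
    (hx : a < (x : ℝ)) : (x : ℝ) = T x + u x := by
  have h1 := h.eq_add (T x) (T x).2
  rwa [h.apply_map x hx] at h1

theorem exists_iterate_mem_Icc (h : IsNeutralExpandingMap T a K κ P u v ψ ψ') {x : HalfLine}
    (hx : a < (x : ℝ)) : ∃ k, (T^[k] x : ℝ) ∈ Icc a (ψ a) := by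
  by_contra! hk
  have hψa := h.lt_apply h.a_pos
  have key : ∀ k : ℕ, ψ a < (T^[k] x : ℝ) ∧ (T^[k] x : ℝ) ≤ x - k * u x := by
    intro k
    induction k with
    | zero =>
      refine ⟨?_, by simp⟩
      by_contra! hlt
      exact hk 0 ⟨hx.le, hlt⟩
    | succ k ih =>
      obtain ⟨h1, h2⟩ := ih
      set z := T^[k] x
      have hz : a < (z : ℝ) := hψa.trans h1
      have hux := h.u_pos _ hx
      have hzx : (z : ℝ) ≤ x := by
        have : 0 ≤ (k : ℝ) * u x := by positivity
        linarith
      have h3 := h.u_anti (show (z : ℝ) ∈ Ioi a from hz) hx hzx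
      have h4 := h.eq_map_add hz
      have h5 : T^[k + 1] x = T z := Function.iterate_succ_apply' T k x
      rw [h5]
      constructor
      · by_contra! hlt
        refine hk (k + 1) ⟨?_, h5 ▸ hlt⟩
        rw [h5]
        by_contra! hlt'
        have := h.mono (T z).2 hlt'.le
        rw [h.apply_map z hz] at this
        linarith
      · push_cast
        linarith
  obtain ⟨n, hn⟩ := exists_nat_gt ((x : ℝ) / u x)
  rw [div_lt_iff₀ (h.u_pos _ hx)] at hn
  obtain ⟨h1, h2⟩ := key n
  linarith [h.a_pos]

theorem exists_iterate_lt (h : IsNeutralExpandingMap T a K κ P u v ψ ψ') {x : HalfLine}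
    (hx : ∀ k, (T^[k] x : ℝ) ∉ P) : ∃ k, (T^[k] x : ℝ) < a := by
  have hne : ∀ k, (T^[k] x : ℝ) ≠ a := fun k hk => hx k (hk ▸ h.mem_exceptional)
  rcases lt_or_gt_of_ne (hne 0) with h0 | h0
  · exact ⟨0, h0⟩
  obtain ⟨k, hk⟩ := h.exists_iterate_mem_Icc (x := x) h0
  refine ⟨k + 1, lt_of_le_of_ne ?_ (hne _)⟩
  rw [Function.iterate_succ_apply']
  have hz : a < (T^[k] x : ℝ) := lt_of_le_of_ne hk.1 (hne k).symm
  by_contra! hlt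
  have h1 := h.mono h.a_pos hlt.le
  rw [h.apply_map _ hz] at h1
  have h2 := h.map_eq (T^[k] x) ⟨a, h.a_pos⟩ (le_antisymm hk.2 h1)
  rw [h2] at hlt
  exact lt_irrefl _ hlt

/-- Uniform bounded distortion along itineraries that end in `(0, a)`. -/
theorem exists_pullback (h : IsNeutralExpandingMap T a K κ P u v ψ ψ') :
    ∃ M : ℝ, 0 < M ∧ ∀ (m : ℕ) (x : HalfLine), (∀ k, (T^[k] x : ℝ) ∉ P) →
      ∃ (n : ℕ) (χ χ' : ℝ → ℝ) (y₀ : ℝ), y₀ ∈ Ioo 0 a ∧ χ y₀ = x ∧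
        IsPullback T a (κ ^ m) (fun _ s _ _ => |s| ≤ M) n χ χ' := by
  obtain ⟨V, hV0, hV⟩ := h.exists_neg_deriv_le
  set w := u (ψ a) with hwdef
  have hw : 0 < w := h.u_pos _ (h.lt_apply h.a_pos)
  have hκ := h.κ_pos
  have hκ1 := h.κ_lt_one
  have hK := h.K_nonneg
  have ha := h.a_pos
  set C := (2 * K + V / w) / (1 - κ) with hCdef
  have hVw : 0 ≤ V / w := by positivity
  have hC0 : 0 ≤ C := div_nonneg (by positivity) (by linarith)
  have hCeq : C * (1 - κ) = 2 * K + V / w := div_mul_cancel₀ _ (by linarith)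
  have hC1 : 2 * K + V / w + C * κ ≤ C := by linarith
  have hC2 : K + V / w ≤ C := by
    have := mul_nonneg hC0 hκ.le
    linarith
  set R := DistortionBound a K C w V u v ψ
  have main : ∀ (m : ℕ) (x : HalfLine), (∀ k, (T^[k] x : ℝ) ∉ P) →
      ∃ (n : ℕ) (χ χ' : ℝ → ℝ) (y₀ : ℝ), y₀ ∈ Ioo 0 a ∧ χ y₀ = x ∧
        IsPullback T a (κ ^ m) R n χ χ' := by
    have hneutral : ∀ (m : ℕ) (x : HalfLine), a < (x : ℝ) →
        (∃ (n : ℕ) (χ χ' : ℝ → ℝ) (y₀ : ℝ), y₀ ∈ Ioo 0 a ∧ χ y₀ = T x ∧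
          IsPullback T a (κ ^ m) R n χ χ') →
        (∃ (n : ℕ) (χ χ' : ℝ → ℝ) (y₀ : ℝ), y₀ ∈ Ioo 0 a ∧ χ y₀ = x ∧
          IsPullback T a (κ ^ m) R n χ χ') := by
      rintro m x hx ⟨n, χ, χ', y₀, hy₀, hχ, hp⟩
      have h1 := hp.prepend h.toIsInverseBranch zero_le_one (fun y hy => h.abs_deriv_le_one hy)
        (fun d s p q hp hq hr => h.distortionBound hV hp hq hr)
      rw [one_mul] at h1
      exact ⟨_, _, _, y₀, hy₀, by rw [Function.comp_apply, hχ, h.apply_map x hx], h1⟩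
    have hexp : ∀ (m : ℕ) (x : HalfLine), (x : ℝ) ∉ P → (x : ℝ) < a →
        (∃ (n : ℕ) (χ χ' : ℝ → ℝ) (y₀ : ℝ), y₀ ∈ Ioo 0 a ∧ χ y₀ = T x ∧
          IsPullback T a (κ ^ m) R n χ χ') →
        (∃ (n : ℕ) (χ χ' : ℝ → ℝ) (y₀ : ℝ), y₀ ∈ Ioo 0 a ∧ χ y₀ = x ∧
          IsPullback T a (κ ^ (m + 1)) R n χ χ') := by
      rintro m x hxP hx ⟨n, χ, χ', y₀, hy₀, hχ, hp⟩
      obtain ⟨I, g, g', hIa, hxI, hg, hgκ⟩ := h.expanding x hxP hx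
      have h1 := hp.prepend hg hκ.le hgκ (fun d s p q hp hq hr =>
        hr.expanding hw h.v_nonpos hC0 hK hV0 hκ.le hC1 (hIa (hg.mem p hp)) (hIa (hg.mem q hq))
          (hg.distortion p q hp hq) (hg.abs_sub_le hgκ hp hq))
      rw [← pow_succ'] at h1
      exact ⟨_, _, _, y₀, hy₀, by rw [Function.comp_apply, hχ, hg.apply_map x hxI], h1⟩
    have hlift : ∀ (m k : ℕ) (x : HalfLine), (∀ k, (T^[k] x : ℝ) ∉ P) →
        (∀ z : HalfLine, (∀ k, (T^[k] z : ℝ) ∉ P) → (z : ℝ) < a →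
          (∃ (n : ℕ) (χ χ' : ℝ → ℝ) (y₀ : ℝ), y₀ ∈ Ioo 0 a ∧ χ y₀ = z ∧
            IsPullback T a (κ ^ m) R n χ χ')) → (T^[k] x : ℝ) < a →
        (∃ (n : ℕ) (χ χ' : ℝ → ℝ) (y₀ : ℝ), y₀ ∈ Ioo 0 a ∧ χ y₀ = x ∧
          IsPullback T a (κ ^ m) R n χ χ') := by
      intro m k
      induction k with
      | zero => exact fun x hx H hlt => H x hx hlt
      | succ k ih =>
        intro x hx H hlt
        rcases lt_or_gt_of_ne (fun hxa => hx 0 (hxa ▸ h.mem_exceptional) : (x : ℝ) ≠ a)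
          with hxa | hxa
        · exact H x hx hxa
        · exact hneutral m x hxa (ih (T x) (fun k => hx (k + 1)) H hlt)
    intro m
    induction m with
    | zero =>
      intro x hx
      obtain ⟨k, hk⟩ := h.exists_iterate_lt hx
      refine hlift 0 k x hx (fun z hz hza => ⟨0, id, fun _ => 1, z, ⟨z.2, hza⟩, rfl, ?_⟩) hk
      refine ⟨fun y hy => hy.1, fun y _ => hasDerivAt_id y, fun _ _ => one_ne_zero, by simp,
        fun x y _ hxy => Subtype.ext hxy, fun y hy z hz => Or.inl ⟨hy.2, hz.2, by simp⟩⟩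
    | succ m ih =>
      intro x hx
      obtain ⟨k, hk⟩ := h.exists_iterate_lt hx
      exact hlift (m + 1) k x hx
        (fun z hz hza => hexp m z (hz 0) hza (ih (T z) fun k => hz (k + 1))) hk
  refine ⟨C * a + 1, by positivity, fun m x hx => ?_⟩
  obtain ⟨n, χ, χ', y₀, hy₀, hχ, hp⟩ := main m x hx
  refine ⟨n, χ, χ', y₀, hy₀, hχ, hp.pos, hp.hasDerivAt, hp.ne_zero, hp.abs_le, hp.map_eq,
    fun y hy z hz => ?_⟩
  have h1 := (hp.bound y hy z hz).abs_le hw h.v_nonpos hC0 hC2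
  have h2 : |y - z| ≤ a := abs_le.2 ⟨by linarith [hy.1, hz.2], by linarith [hy.2, hz.1]⟩
  have h3 := mul_le_mul_of_nonneg_left h2 hC0
  linarith

end IsNeutralExpandingMap

theorem lebHalfLine_apply (s : Set HalfLine) : lebHalfLine s = volume (Subtype.val '' s) :=
  (MeasurableEmbedding.subtype_coe measurableSet_Ioi).comap_apply volume s

theorem ae_lebHalfLine_of_ae {p : ℝ → Prop} (hp : ∀ᵐ x : ℝ, p x) :
    ∀ᵐ x : HalfLine ∂lebHalfLine, p (x : ℝ) := by
  rw [ae_iff, lebHalfLine_apply]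
  refine measure_mono_null ?_ (ae_iff.1 hp)
  rintro _ ⟨x, hx, rfl⟩
  exact hx

theorem lebHalfLine_setOf_lt (a : ℝ) :
    lebHalfLine {x : HalfLine | (x : ℝ) < a} = ENNReal.ofReal a := by
  have : Subtype.val '' {x : HalfLine | (x : ℝ) < a} = Ioo 0 a := by
    ext t
    simp [and_comm]
  rw [lebHalfLine_apply, this, Real.volume_Ioo, sub_zero]

namespace IsNeutralExpandingMap

variable {T : HalfLine → HalfLine} {a K κ : ℝ} {P : Set ℝ} {u v ψ ψ' : ℝ → ℝ}

theorem ae_forall_iterate_notMem (h : IsNeutralExpandingMap T a K κ P u v ψ ψ')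
    (hT : Measure.QuasiMeasurePreserving T lebHalfLine lebHalfLine) :
    ∀ᵐ x ∂lebHalfLine, ∀ k, (T^[k] x : ℝ) ∉ P := by
  refine ae_all_iff.2 fun k => (hT.iterate k).ae (p := fun x => (x : ℝ) ∉ P) ?_
  exact ae_lebHalfLine_of_ae (p := fun x => x ∉ P) (h.countable.ae_notMem volume)

/-- Some iterate of a set of positive measure fills `(0, a)` up to a set of small measure. -/
theorem exists_iterate_dense (h : IsNeutralExpandingMap T a K κ P u v ψ ψ')
    (hT : Measure.QuasiMeasurePreserving T lebHalfLine lebHalfLine) {A : Set HalfLine}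
    (hA : MeasurableSet A) (hA0 : lebHalfLine A ≠ 0) {ε : ℝ} (hε : 0 < ε) :
    ∃ n, ∀ F : Set HalfLine, (∀ x ∈ A, T^[n] x ∈ F) →
      lebHalfLine ({x | (x : ℝ) < a} \ F) ≤ ENNReal.ofReal ε := by
  obtain ⟨M, hM, hpull⟩ := h.exists_pullback
  have ha := h.a_pos
  set E := Real.exp M with hE
  have hE0 : 0 < E := Real.exp_pos M
  have hA' : MeasurableSet (Subtype.val '' A : Set ℝ) :=
    (MeasurableEmbedding.subtype_coe measurableSet_Ioi).measurableSet_image.2 hA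
  have hε' : 0 < ε / (E ^ 2 * a) := by positivity
  have hex : ∃ x ∈ A, (∀ k, (T^[k] x : ℝ) ∉ P) ∧ ∃ r₀ > 0, ∀ r, 0 < r → r < r₀ →
      volume (Metric.closedBall (x : ℝ) r \ Subtype.val '' A) ≤
        ENNReal.ofReal (ε / (E ^ 2 * a) * r) := by
    by_contra! hno
    refine hA0 (measure_eq_zero_iff_ae_notMem.2 ?_)
    filter_upwards [h.ae_forall_iterate_notMem hT,
      ae_lebHalfLine_of_ae (ae_density (A := Subtype.val '' A) hε')] with x hx hx' hxA
    obtain ⟨r₀, hr₀, H⟩ := hx' hA' (mem_image_of_mem _ hxA)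
    obtain ⟨r, h1, h2, h3⟩ := hno x hxA hx r₀ hr₀
    exact absurd (H r h1 h2) (not_le.2 h3)
  obtain ⟨x, hxA, hxP, r₀, hr₀, hdens⟩ := hex
  obtain ⟨m, hm⟩ := exists_pow_lt_of_lt_one (show 0 < r₀ / (E * a) by positivity) h.κ_lt_one
  obtain ⟨n, χ, χ', y₀, hy₀, hχ, hp⟩ := hpull m x hxP
  refine ⟨n, fun F hF => ?_⟩
  set ℓ := |χ' y₀| with hℓ
  have hℓ0 : 0 < ℓ := abs_pos.2 (hp.ne_zero y₀ hy₀)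
  have hlog : ∀ y ∈ Ioo 0 a, ∀ z ∈ Ioo 0 a, |χ' y| ≤ E * |χ' z| := by
    intro y hy z hz
    have h1 := (abs_le.1 (hp.bound y hy z hz)).2
    have hy' := abs_pos.2 (hp.ne_zero y hy)
    have hz' := abs_pos.2 (hp.ne_zero z hz)
    rw [← Real.log_abs (χ' y), ← Real.log_abs (χ' z)] at h1
    rw [← Real.exp_log hy', ← Real.exp_log hz', hE, ← Real.exp_add, Real.exp_le_exp]
    linarith
  set r := E * ℓ * a with hr
  have hr0 : 0 < r := by positivity
  have hrr₀ : r < r₀ := by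
    rw [lt_div_iff₀ (by positivity)] at hm
    have h1 : ℓ * (E * a) ≤ κ ^ m * (E * a) :=
      mul_le_mul_of_nonneg_right (hp.abs_le y₀ hy₀) (by positivity)
    calc r = ℓ * (E * a) := by rw [hr]; ring
      _ < r₀ := h1.trans_lt hm
  have hball : ∀ y ∈ Ioo 0 a, χ y ∈ Metric.closedBall (x : ℝ) r := by
    intro y hy
    rw [Metric.mem_closedBall, Real.dist_eq, ← hχ]
    refine (abs_sub_le_of_abs_deriv_le ordConnected_Ioo hp.hasDerivAt
      (fun t ht => hlog t ht y₀ hy₀) hy hy₀).trans ?_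
    refine mul_le_mul_of_nonneg_left ?_ (by positivity)
    exact abs_le.2 ⟨by linarith [hy.1, hy₀.2], by linarith [hy.2, hy₀.1]⟩
  have hlow : ∀ y ∈ Ioo 0 a, ℓ / E ≤ |χ' y| := by
    intro y hy
    rw [div_le_iff₀ hE0, mul_comm]
    exact hlog y₀ hy₀ y hy
  rw [lebHalfLine_apply]
  calc volume (Subtype.val '' ({x : HalfLine | (x : ℝ) < a} \ F))
      ≤ volume (Ioo 0 a ∩ χ ⁻¹' (Metric.closedBall (x : ℝ) r \ Subtype.val '' A)) := by
        refine measure_mono ?_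
        rintro _ ⟨y, ⟨hya, hyF⟩, rfl⟩
        have hy : (y : ℝ) ∈ Ioo 0 a := ⟨y.2, hya⟩
        refine ⟨hy, hball y hy, ?_⟩
        rintro ⟨t, htA, ht⟩
        exact hyF (hp.map_eq t y hya ht ▸ hF t htA)
    _ ≤ ENNReal.ofReal (ℓ / E)⁻¹ * volume (Metric.closedBall (x : ℝ) r \ Subtype.val '' A) :=
        volume_inter_preimage_le ordConnected_Ioo hp.hasDerivAt (by positivity) hlow _
    _ ≤ ENNReal.ofReal (ℓ / E)⁻¹ * ENNReal.ofReal (ε / (E ^ 2 * a) * r) := by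
        gcongr
        exact hdens r hr0 hrr₀
    _ = ENNReal.ofReal ε := by
        rw [← ENNReal.ofReal_mul (by positivity), hr]
        congr 1
        field_simp

/-- The measure of a bounded set is controlled by the measure of the part of its preimage that
lies in `(0, a)`. -/
theorem exists_measure_le (h : IsNeutralExpandingMap T a K κ P u v ψ ψ') {M : ℝ} (hM : 0 < M) :
    ∃ c : ℝ, 0 < c ∧ ∀ B B' : Set HalfLine, (∀ y ∈ B', (y : ℝ) < M) →
      (∀ x : HalfLine, (x : ℝ) < a → T x ∈ B' → x ∈ B) →
      lebHalfLine B' ≤ ENNReal.ofReal c * lebHalfLine B := by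
  obtain ⟨t, htP, ht⟩ := (h.countable.dense_compl ℝ).exists_between h.a_pos
  obtain ⟨I, χ, χ', hIa, -, hχ, -⟩ := h.expanding ⟨t, ht.1⟩ htP ht.2
  obtain ⟨c, hc, hc'⟩ := hχ.exists_pos_le h.K_nonneg hM
  refine ⟨c⁻¹, inv_pos.2 hc, fun B B' hB' hB => ?_⟩
  rw [lebHalfLine_apply, lebHalfLine_apply]
  refine le_trans (measure_mono ?_) (volume_inter_preimage_le ordConnected_Ioo
    (fun y hy => hχ.hasDerivAt y hy.1) hc hc' _)
  rintro _ ⟨y, hy, rfl⟩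
  refine ⟨⟨y.2, hB' y hy⟩, ⟨χ y, hχ.pos y y.2⟩, hB _ (hIa (hχ.mem y y.2)) ?_, rfl⟩
  rwa [hχ.map_eq _ y rfl]

theorem measure_setOf_forall_iterate_lt (h : IsNeutralExpandingMap T a K κ P u v ψ ψ')
    (hT : Measure.QuasiMeasurePreserving T lebHalfLine lebHalfLine) :
    lebHalfLine {x | ∀ k, (T^[k] x : ℝ) < a} = 0 := by
  set S := {x : HalfLine | ∀ k, (T^[k] x : ℝ) < a} with hS
  have ha := h.a_pos
  have hSm : MeasurableSet S := by
    rw [hS, ofPred_forall]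
    exact MeasurableSet.iInter fun k => measurableSet_lt
      (measurable_subtype_coe.comp (hT.measurable.iterate k)) measurable_const
  by_contra hS0
  have hnull : lebHalfLine ({x | (x : ℝ) < a} \ S) = 0 := by
    refine le_antisymm (le_of_forall_pos_le_add fun ε hε => ?_) zero_le
    rw [zero_add]
    rcases eq_or_ne ε ⊤ with rfl | hε'
    · exact le_top
    obtain ⟨n, hn⟩ := h.exists_iterate_dense hT hSm hS0 (ENNReal.toReal_pos hε.ne' hε')
    have := hn S fun x hx k => by
      rw [← Function.iterate_add_apply]
      exact hx _
    rwa [ENNReal.ofReal_toReal hε'] at this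
  obtain ⟨c, hc, hc'⟩ := h.exists_measure_le (M := 2 * a) (by positivity)
  have h1 := hc' ({x | (x : ℝ) < a} \ S) {y | (y : ℝ) ∈ Ioo a (2 * a)} (fun y hy => hy.2)
    (fun x hx hTx => ⟨hx, fun hxS => absurd (hxS 1) (not_lt.2 hTx.1.le)⟩)
  rw [hnull, mul_zero, lebHalfLine_apply] at h1
  have h2 : Ioo a (2 * a) ⊆ Subtype.val '' {y : HalfLine | (y : ℝ) ∈ Ioo a (2 * a)} :=
    fun t ht => ⟨⟨t, ha.trans ht.1⟩, ht, rfl⟩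
  have h3 := (measure_mono (μ := volume) h2).trans h1
  rw [Real.volume_Ioo] at h3
  have : 2 * a - a ≤ 0 := by simpa using h3
  linarith

theorem ae_frequently_mem_Icc (h : IsNeutralExpandingMap T a K κ P u v ψ ψ')
    (hT : Measure.QuasiMeasurePreserving T lebHalfLine lebHalfLine) :
    ∀ᵐ x ∂lebHalfLine, ∃ᶠ n in atTop, T^[n] x ∈ {y : HalfLine | (y : ℝ) ∈ Icc a (ψ a)} := by
  have hS : ∀ᵐ x ∂lebHalfLine, ∀ n, ¬ ∀ k, (T^[k] (T^[n] x) : ℝ) < a :=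
    ae_all_iff.2 fun n => (hT.iterate n).ae
      (measure_eq_zero_iff_ae_notMem.1 (h.measure_setOf_forall_iterate_lt hT))
  filter_upwards [hS, h.ae_forall_iterate_notMem hT] with x hx hxP
  refine frequently_atTop.2 fun N => ?_
  have := hx N
  push Not at this
  obtain ⟨k, hk⟩ := this
  rw [← Function.iterate_add_apply] at hk
  have hlt : a < (T^[k + N] x : ℝ) :=
    lt_of_le_of_ne hk fun heq => hxP (k + N) (heq ▸ h.mem_exceptional)
  obtain ⟨j, hj⟩ := h.exists_iterate_mem_Icc hlt
  rw [← Function.iterate_add_apply] at hj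
  exact ⟨j + (k + N), by omega, hj⟩

theorem surjective (h : IsNeutralExpandingMap T a K κ P u v ψ ψ') : Function.Surjective T :=
  fun y => ⟨⟨ψ y, h.pos y y.2⟩, h.map_eq _ y rfl⟩

/-- A tail set cannot be disjoint, along its whole forward orbit, from its next iterate. -/
theorem measure_eq_zero_of_disjoint (h : IsNeutralExpandingMap T a K κ P u v ψ ψ')
    (hT : Measure.QuasiMeasurePreserving T lebHalfLine lebHalfLine) {F : ℕ → Set HalfLine}
    (hF : ∀ n, MeasurableSet (F n)) (hFT : ∀ n, F n = T ⁻¹' F (n + 1))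
    (hdisj : ∀ n, Disjoint (F n) (F (n + 1))) : lebHalfLine (F 0) = 0 := by
  by_contra h0
  have ha := h.a_pos
  have hiter : ∀ n, ∀ x ∈ F 0, T^[n] x ∈ F n := by
    intro n x hx
    induction n with
    | zero => exact hx
    | succ n ih =>
      rw [Function.iterate_succ_apply']
      rwa [hFT n] at ih
  obtain ⟨c, hc, hc'⟩ := h.exists_measure_le ha
  set ε := a / (2 * (1 + c)) with hεdef
  have hε : 0 < ε := by positivity
  obtain ⟨n, hn⟩ := h.exists_iterate_dense hT (hF 0) h0 hε
  set J := {x : HalfLine | (x : ℝ) < a}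
  have h1 : lebHalfLine (J \ F n) ≤ ENNReal.ofReal ε := hn _ (hiter n)
  have h2 : lebHalfLine (J \ F (n + 1)) ≤ ENNReal.ofReal c * lebHalfLine (J \ F n) := by
    refine hc' _ _ (fun y hy => hy.1) fun x hx hTx => ⟨hx, fun hxF => hTx.2 ?_⟩
    rwa [hFT n] at hxF
  have h3 : J ⊆ (J \ F n) ∪ (J \ F (n + 1)) := by
    intro x hx
    by_cases hxF : x ∈ F n
    · exact Or.inr ⟨hx, fun hx' => disjoint_left.1 (hdisj n) hxF hx'⟩
    · exact Or.inl ⟨hx, hxF⟩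
  have h4 : ENNReal.ofReal a ≤ ENNReal.ofReal (ε + c * ε) := by
    rw [← lebHalfLine_setOf_lt a, ENNReal.ofReal_add hε.le (by positivity),
      ENNReal.ofReal_mul hc.le]
    refine (measure_mono h3).trans ((measure_union_le _ _).trans (add_le_add h1 (h2.trans ?_)))
    gcongr
  rw [ENNReal.ofReal_le_ofReal_iff (by positivity)] at h4
  have h5 : ε + c * ε = a / 2 := by rw [hεdef]; field_simp
  linarith

theorem ae_eq_succ (h : IsNeutralExpandingMap T a K κ P u v ψ ψ')
    (hT : Measure.QuasiMeasurePreserving T lebHalfLine lebHalfLine) {F : ℕ → Set HalfLine}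
    (hF : ∀ n, MeasurableSet (F n)) (hFT : ∀ n, F n = T ⁻¹' F (n + 1)) (n : ℕ) :
    F n =ᵐ[lebHalfLine] F 0 := by
  have hpre : ∀ n x, x ∈ F n ↔ T x ∈ F (n + 1) := fun n x => by
    conv_lhs => rw [hFT n]
    rfl
  induction n with
  | zero => rfl
  | succ n ih =>
    refine EventuallyEq.trans ?_ ih
    refine ae_eq_set.2 ⟨?_, ?_⟩
    · refine h.measure_eq_zero_of_disjoint hT (F := fun k => F (n + k + 1) \ F (n + k))
        (fun k => (hF _).diff (hF _)) (fun k => ?_) (fun k => ?_)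
      · ext x
        exact and_congr (hpre (n + k + 1) x) (not_congr (hpre (n + k) x))
      · exact disjoint_left.2 fun x hx hx' => hx'.2 hx.1
    · refine h.measure_eq_zero_of_disjoint hT (F := fun k => F (n + k) \ F (n + k + 1))
        (fun k => (hF _).diff (hF _)) (fun k => ?_) (fun k => ?_)
      · ext x
        exact and_congr (hpre (n + k) x) (not_congr (hpre (n + k + 1) x))
      · exact disjoint_left.2 fun x hx hx' => hx.2 hx'.1

theorem measure_diff_tail_eq_zero (h : IsNeutralExpandingMap T a K κ P u v ψ ψ')
    (hT : Measure.QuasiMeasurePreserving T lebHalfLine lebHalfLine) {F : ℕ → Set HalfLine}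
    (hF : ∀ n, MeasurableSet (F n)) (hFT : ∀ n, F n = T ⁻¹' F (n + 1))
    (h0 : lebHalfLine (F 0) ≠ 0) : lebHalfLine ({x | (x : ℝ) < a} \ F 0) = 0 := by
  refine le_antisymm (le_of_forall_pos_le_add fun ε hε => ?_) zero_le
  rw [zero_add]
  rcases eq_or_ne ε ⊤ with rfl | hε'
  · exact le_top
  obtain ⟨n, hn⟩ := h.exists_iterate_dense hT (hF 0) h0 (ENNReal.toReal_pos hε.ne' hε')
  have h1 := hn (F n) fun x hx => by
    clear hn
    induction n with
    | zero => exact hx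
    | succ n ih =>
      rw [Function.iterate_succ_apply']
      rwa [hFT n] at ih
  rw [ENNReal.ofReal_toReal hε'] at h1
  refine le_of_eq_of_le ?_ h1
  exact measure_congr ((EventuallyEq.refl _ _).diff (h.ae_eq_succ hT hF hFT n).symm)

theorem isExactMap (h : IsNeutralExpandingMap T a K κ P u v ψ ψ')
    (hT : Measure.QuasiMeasurePreserving T lebHalfLine lebHalfLine) :
    IsExactMap T lebHalfLine := by
  intro s hs
  have hs' : ∀ n, ∃ F : Set HalfLine, MeasurableSet F ∧ T^[n] ⁻¹' F = s := fun n =>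
    MeasurableSpace.measurableSet_comap.1 (MeasurableSpace.measurableSet_iInf.1 hs n)
  choose F hF hFs using hs'
  have hFT : ∀ n, F n = T ⁻¹' F (n + 1) := by
    intro n
    apply (h.surjective.iterate n).preimage_injective
    rw [hFs n, ← hFs (n + 1), Function.iterate_succ', preimage_comp]
  have hF0 : F 0 = s := hFs 0
  by_contra! hne
  rw [← hF0] at hne
  have h1 := h.measure_diff_tail_eq_zero hT hF hFT hne.1
  have h2 := h.measure_diff_tail_eq_zero hT (F := fun n => (F n)ᶜ) (fun n => (hF n).compl)
    (fun n => by rw [hFT n]; rfl) hne.2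
  have h3 : lebHalfLine {x : HalfLine | (x : ℝ) < a} = 0 := by
    refine measure_mono_null (fun x hx => ?_) (measure_union_null h1 h2)
    by_cases hxF : x ∈ F 0
    · exact Or.inr ⟨hx, fun h => h hxF⟩
    · exact Or.inl ⟨hx, hxF⟩
  rw [lebHalfLine_setOf_lt a] at h3
  exact absurd h3 (by simpa using h.a_pos)

end IsNeutralExpandingMap

theorem iteratedDerivWithin_two_eq_deriv_deriv {f : ℝ → ℝ} {I D : Set ℝ} (hI : IsOpen I)
    (hID : I ⊆ D) {x : ℝ} (hx : x ∈ I) :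
    iteratedDerivWithin 2 f D x = deriv (deriv f) x := by
  have hnhds : ∀ t ∈ I, D ∈ 𝓝 t := fun t ht => mem_of_superset (hI.mem_nhds ht) hID
  rw [iteratedDerivWithin_succ, derivWithin_of_mem_nhds (hnhds x hx), iteratedDerivWithin_one]
  refine EventuallyEq.deriv_eq ?_
  filter_upwards [hI.mem_nhds hx] with t ht
  exact derivWithin_of_mem_nhds (hnhds t ht)

theorem isOpen_partitionInterval (a : ℕ → ℝ) (j : ℕ) : IsOpen (partitionInterval a j) := by
  unfold partitionInterval
  split_ifs
  exacts [isOpen_Ioi, isOpen_Ioo]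

theorem IsBranchDomain.partitionInterval_subset {a : ℕ → ℝ} {j : ℕ} {D : Set ℝ}
    (h : IsBranchDomain a j D) : partitionInterval a j ⊆ D := by
  unfold partitionInterval
  rcases h with ⟨rfl, rfl⟩ | ⟨hj, rfl | rfl⟩
  · simp
  · simpa [hj] using Ioo_subset_Ico_self
  · simpa [hj] using Ioo_subset_Ioc_self

theorem exists_isInverseBranch_of_hasFullBranches {N : ℕ∞} {a : ℕ → ℝ} {T : HalfLine → HalfLine}
    {D : ℕ → Set ℝ} {φ : ℕ → ℝ → ℝ} (hφ : HasFullBranches N a T D φ) {K : ℝ}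
    (hK : ∀ j ∈ branchIndex N, ∀ x ∈ D j,
      |iteratedDerivWithin 2 (φ j) (D j) x| / |derivWithin (φ j) (D j) x| ^ 2 ≤ K)
    {j : ℕ} (hj : j ∈ branchIndex N)
    (hne : ∀ x ∈ partitionInterval a j, deriv (φ j) x ≠ 0) :
    ∃ ψ ψ' : ℝ → ℝ, IsInverseBranch T (partitionInterval a j) K ψ ψ' ∧
      ∀ y, 0 < y → ψ' y = (deriv (φ j) (ψ y))⁻¹ := by
  have hI := isOpen_partitionInterval a j
  have hID := (hφ.domain j hj).partitionInterval_subset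
  have hnhds : ∀ x ∈ partitionInterval a j, D j ∈ 𝓝 x := fun x hx =>
    mem_of_superset (hI.mem_nhds hx) hID
  refine exists_isInverseBranch hI (hφ.bijOn j hj) (hφ.extends_map j hj)
    (fun x hx => (hφ.contDiffOn j hj).contDiffAt (hnhds x hx)) hne (fun x hx => ?_)
  have := hK j hj x (hID hx)
  rwa [iteratedDerivWithin_two_eq_deriv_deriv hI hID hx,
    derivWithin_of_mem_nhds (hnhds x hx)] at this

namespace IsPartitionSeq

variable {N : ℕ∞} {a : ℕ → ℝ}

theorem le_first (h : IsPartitionSeq N a) (k : ℕ) (hk : ((k + 1 : ℕ) : ℕ∞) ≤ N) :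
    a (k + 1) ≤ a 1 := by
  induction k with
  | zero => exact le_rfl
  | succ k ih =>
    have hlt : ((k + 1 : ℕ) : ℕ∞) < N :=
      lt_of_lt_of_le (by exact_mod_cast Nat.lt_succ_self (k + 1)) hk
    exact (h.strict_anti (k + 1) hlt (by omega)).le.trans (ih hlt.le)

theorem first_nonneg (h : IsPartitionSeq N a) : 0 ≤ a 1 := by
  induction N using ENat.recTopCoe with
  | top =>
    refine le_of_tendsto ((tendsto_add_atTop_iff_nat 1).2 (h.tendsto_zero rfl))
      (Eventually.of_forall fun k => h.le_first k le_top)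
  | coe n =>
    obtain ⟨k, rfl⟩ : ∃ k, n = k + 1 :=
      ⟨n - 1, by have : 1 ≤ n := by exact_mod_cast h.one_le
                 omega⟩
    exact (h.last_eq_zero _ rfl).symm.le.trans (h.le_first k le_rfl)

/-- Every point of `(0, a₁)` outside the sequence lies in one of the partition intervals. -/
theorem exists_mem_partitionInterval (h : IsPartitionSeq N a) {x : ℝ} (hx0 : 0 < x)
    (hx1 : x < a 1) (hxa : x ∉ range a) :
    ∃ j ∈ branchIndex N, 1 ≤ j ∧ x ∈ partitionInterval a j := by
  classical
  have hex : ∃ k : ℕ, 1 ≤ k ∧ (k : ℕ∞) ≤ N ∧ a k < x := by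
    induction N using ENat.recTopCoe with
    | top =>
      obtain ⟨k, hk, hk'⟩ := (((h.tendsto_zero rfl).eventually (gt_mem_nhds hx0)).and
        (eventually_ge_atTop 1)).exists
      exact ⟨k, hk', le_top, hk⟩
    | coe n =>
      exact ⟨n, by exact_mod_cast h.one_le, le_rfl, by rwa [h.last_eq_zero n rfl]⟩
  obtain ⟨h1, h2, h3⟩ := Nat.find_spec hex
  set k := Nat.find hex with hk
  have hk1 : k ≠ 1 := fun hk1 => by
    rw [hk1] at h3
    linarith
  obtain ⟨j, hj⟩ : ∃ j, k = j + 1 := ⟨k - 1, by omega⟩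
  rw [hj] at h2 h3
  have hjN : (j : ℕ∞) < N := lt_of_lt_of_le (by exact_mod_cast Nat.lt_succ_self j) h2
  have hj1 : 1 ≤ j := by omega
  refine ⟨j, hjN, hj1, ?_⟩
  have hmin := Nat.find_min hex (m := j) (by omega)
  have hxj : x ≤ a j := by
    by_contra! hlt
    exact hmin ⟨hj1, hjN.le, hlt⟩
  rw [partitionInterval, if_neg (by omega)]
  exact ⟨h3, lt_of_le_of_ne hxj fun heq => hxa ⟨j, heq.symm⟩⟩

end IsPartitionSeq

theorem ConvexOn.antitoneOn_of_tendsto_zero {f : ℝ → ℝ} {a : ℝ} (hf : ConvexOn ℝ (Ici a) f)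
    (hpos : ∀ x ∈ Ici a, 0 < f x) (hlim : Tendsto f atTop (𝓝 0)) : AntitoneOn f (Ici a) := by
  intro x hx y hy hxy
  by_contra! hlt
  have hxy' : x < y := lt_of_le_of_ne hxy fun heq => by
    rw [heq] at hlt
    exact lt_irrefl _ hlt
  obtain ⟨z, hz, hyz⟩ := ((hlim.eventually (gt_mem_nhds (hpos y hy))).and
    (eventually_gt_atTop y)).exists
  have hs := hf.slope_mono_adjacent hx (show z ∈ Ici a from le_trans hy hyz.le) hxy' hyz
  have h1 : 0 < (f y - f x) / (y - x) := div_pos (by linarith) (by linarith)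
  have h2 : (f z - f y) / (z - y) < 0 := div_neg_of_neg_of_pos (by linarith) (by linarith)
  linarith

theorem exists_isNeutralExpandingMap {N : ℕ∞} {a : ℕ → ℝ} {T : HalfLine → HalfLine}
    {D : ℕ → Set ℝ} {φ : ℕ → ℝ → ℝ} (hpart : IsPartitionSeq N a)
    (hφ : HasFullBranches N a T D φ) (hexp : IsExpandingOffZerothBranch N D φ)
    (hratio : HasBoundedSecondDerivativeRatio N D φ) (hneut : IsNeutralAtInfinity a (φ 0)) :
    ∃ (K κ : ℝ) (u v ψ ψ' : ℝ → ℝ),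
      IsNeutralExpandingMap T (a 1) K κ (range a) u v ψ ψ' := by
  obtain ⟨Λ, hΛ, hΛφ⟩ := hexp
  obtain ⟨K, hK, hKφ⟩ := hratio
  have h0 : (0 : ℕ) ∈ branchIndex N :=
    lt_of_lt_of_le (by norm_num) hpart.one_le
  have hI0 : partitionInterval a 0 = Ioi (a 1) := if_pos rfl
  have hD0 : D 0 = Ici (a 1) := by
    rcases hφ.domain 0 h0 with ⟨-, h⟩ | ⟨h, -⟩
    exacts [h, absurd rfl h]
  have hnhds : ∀ x ∈ Ioi (a 1), Ici (a 1) ∈ 𝓝 x := fun x hx => Ici_mem_nhds hx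
  have hcont : ContDiffOn ℝ 2 (φ 0) (Ici (a 1)) := hD0 ▸ hφ.contDiffOn 0 h0
  have ha0 := hpart.first_nonneg
  have ha : 0 < a 1 := by
    have hlim : Tendsto (φ 0) (𝓝[>] (a 1)) (𝓝 (φ 0 (a 1))) :=
      (hcont.continuousOn (a 1) self_mem_Ici).mono Ioi_subset_Ici_self
    have hnonneg : 0 ≤ φ 0 (a 1) := by
      refine ge_of_tendsto hlim ?_
      filter_upwards [self_mem_nhdsWithin] with x hx
      have hx0 : 0 < x := ha0.trans_lt hx
      rw [hφ.extends_map 0 h0 ⟨x, hx0⟩ (hI0.symm ▸ hx)]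
      exact (T ⟨x, hx0⟩).2.le
    linarith [hneut.pos (a 1) self_mem_Ici]
  set u : ℝ → ℝ := fun x => x - φ 0 x with hu
  have hφat : ∀ x ∈ Ioi (a 1), ContDiffAt ℝ 2 (φ 0) x := fun x hx =>
    hcont.contDiffAt (hnhds x hx)
  have huat : ∀ x ∈ Ioi (a 1), ContDiffAt ℝ 2 u x := fun x hx =>
    contDiffAt_id.sub (hφat x hx)
  have hudiff : ∀ x ∈ Ioi (a 1), DifferentiableAt ℝ u x := fun x hx =>
    (huat x hx).differentiableAt (by norm_num)
  have hvdiff : ∀ x ∈ Ioi (a 1), DifferentiableAt ℝ (deriv u) x := fun x hx =>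
    ((huat x hx).derivWithin (m := 1) (by norm_num)).differentiableAt (by norm_num)
  have huanti : AntitoneOn u (Ici (a 1)) :=
    hneut.convexOn.antitoneOn_of_tendsto_zero hneut.pos hneut.tendsto_zero
  have hderiv : ∀ x ∈ Ioi (a 1), deriv (φ 0) x = 1 - deriv u x := by
    intro x hx
    have h1 : deriv u x = 1 - deriv (φ 0) x :=
      ((hasDerivAt_id x).sub ((hφat x hx).differentiableAt (by norm_num)).hasDerivAt).deriv
    rw [h1]
    ring
  have hvnonpos : ∀ x ∈ Ioi (a 1), deriv u x ≤ 0 := by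
    intro x hx
    rw [← derivWithin_of_mem_nhds (hnhds x hx)]
    exact huanti.derivWithin_nonpos
  have huconv : ConvexOn ℝ (Ioi (a 1)) u :=
    hneut.convexOn.subset Ioi_subset_Ici_self (convex_Ioi _)
  obtain ⟨ψ, ψ', hψ, hψ'⟩ := exists_isInverseBranch_of_hasFullBranches hφ hKφ h0
    (fun x hx => by
      rw [hI0] at hx
      rw [hderiv x hx]
      linarith [hvnonpos x hx])
  rw [hI0] at hψ
  refine ⟨K, Λ⁻¹, u, deriv u, ψ, ψ', ⟨hψ, ha, hK.le, fun y hy => ?_, fun y hy => ?_,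
    fun x hx => hneut.pos x (le_of_lt hx), huconv, huanti.mono Ioi_subset_Ici_self, hvnonpos,
    huconv.monotoneOn_deriv hudiff, ?_⟩, inv_pos.2 (by linarith), inv_lt_one_of_one_lt₀ hΛ,
    countable_range a, mem_range_self 1, fun x hxP hx => ?_⟩
  · have h1 := hφ.extends_map 0 h0 ⟨ψ y, hψ.pos y hy⟩ (hI0.symm ▸ hψ.mem y hy)
    rw [hψ.map_eq ⟨ψ y, hψ.pos y hy⟩ ⟨y, hy⟩ rfl] at h1
    simp only [hu, h1]
    ring
  · rw [hψ' y hy, hderiv _ (hψ.mem y hy)]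
  · refine AntitoneOn.concaveOn_of_deriv (convex_Ioi _)
      (fun x hx => (hvdiff x hx).continuousAt.continuousWithinAt)
      (fun x hx => (hvdiff x (interior_subset hx)).differentiableWithinAt) ?_
    rw [interior_Ioi]
    refine (hneut.antitoneOn.mono Ioi_subset_Ici_self).congr fun x hx => ?_
    exact iteratedDerivWithin_two_eq_deriv_deriv isOpen_Ioi Ioi_subset_Ici_self hx
  · obtain ⟨j, hj, hj1, hxj⟩ := hpart.exists_mem_partitionInterval x.2 hx hxP
    have hlow : ∀ t ∈ partitionInterval a j, Λ ≤ |deriv (φ j) t| := by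
      intro t ht
      have hsub := (hφ.domain j hj).partitionInterval_subset
      rw [← derivWithin_of_mem_nhds (mem_of_superset
        ((isOpen_partitionInterval a j).mem_nhds ht) hsub)]
      exact hΛφ j hj hj1 t (hsub ht)
    obtain ⟨χ, χ', hχ, hχ'⟩ := exists_isInverseBranch_of_hasFullBranches hφ hKφ hj
      (fun t ht => abs_pos.1 (by linarith [hlow t ht]))
    refine ⟨_, χ, χ', fun t ht => ?_, hxj, hχ, fun y hy => ?_⟩
    · rw [partitionInterval, if_neg (by omega)] at ht
      obtain ⟨i, rfl⟩ : ∃ i, j = i + 1 := ⟨j - 1, by omega⟩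
      exact ht.2.trans_le (hpart.le_first i (le_of_lt hj))
    · rw [hχ' y hy, abs_inv]
      exact inv_anti₀ (by linarith) (hlow _ (hχ.mem y hy))

namespace PreservesPositiveDensity

variable {T : HalfLine → HalfLine} {h : HalfLine → ℝ}

theorem densityMeasure_absolutelyContinuous (h : HalfLine → ℝ) : densityMeasure h ≪ lebHalfLine :=
  withDensity_absolutelyContinuous _ _

theorem lebHalfLine_absolutelyContinuous (hh : PreservesPositiveDensity T h) :
    lebHalfLine ≪ densityMeasure h := by
  refine withDensity_absolutelyContinuous'
    hh.locallyIntegrable.aestronglyMeasurable.aemeasurable.ennreal_ofReal ?_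
  filter_upwards [hh.pos] with x hx
  simpa using hx

theorem quasiMeasurePreserving (hh : PreservesPositiveDensity T h) :
    Measure.QuasiMeasurePreserving T lebHalfLine lebHalfLine :=
  hh.measurePreserving.quasiMeasurePreserving.mono hh.lebHalfLine_absolutelyContinuous
    (densityMeasure_absolutelyContinuous h)

theorem densityMeasure_Icc_ne_top (hh : PreservesPositiveDensity T h) {a b : ℝ} (ha : 0 < a) :
    densityMeasure h {y : HalfLine | (y : ℝ) ∈ Icc a b} ≠ ⊤ := by
  have hmeas : MeasurableSet {y : HalfLine | (y : ℝ) ∈ Icc a b} :=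
    measurable_subtype_coe measurableSet_Icc
  have hcomp : IsCompact {y : HalfLine | (y : ℝ) ∈ Icc a b} := by
    rw [Subtype.isCompact_iff]
    have : Subtype.val '' {y : HalfLine | (y : ℝ) ∈ Icc a b} = Icc a b := by
      ext t
      constructor
      · rintro ⟨y, hy, rfl⟩
        exact hy
      · exact fun ht => ⟨⟨t, ha.trans_le ht.1⟩, ht, rfl⟩
    rw [this]
    exact isCompact_Icc
  rw [densityMeasure, withDensity_apply _ hmeas]
  exact (hh.locallyIntegrable.integrableOn_isCompact hcomp).lintegral_lt_top.ne

end PreservesPositiveDensity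

theorem theorem2p6 (N : ℕ∞) (a : ℕ → ℝ) (T : HalfLine → HalfLine)
    (D : ℕ → Set ℝ) (φ : ℕ → ℝ → ℝ) (h : HalfLine → ℝ)
    (hpart : IsPartitionSeq N a)
    (hB1 : HasFullBranches N a T D φ)
    (hB2 : IsExpandingOffZerothBranch N D φ)
    (hB3 : HasBoundedSecondDerivativeRatio N D φ)
    (hB4 : IsNeutralAtInfinity a (φ 0))
    (hB5 : PreservesPositiveDensity T h) :
    (Conservative T lebHalfLine ∧ IsExactMap T lebHalfLine) ∧
      (Conservative T (densityMeasure h) ∧ IsExactMap T (densityMeasure h)) := by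
  obtain ⟨K, κ, u, v, ψ, ψ', hsys⟩ := exists_isNeutralExpandingMap hpart hB1 hB2 hB3 hB4
  have hT := hB5.quasiMeasurePreserving
  have hac := PreservesPositiveDensity.densityMeasure_absolutelyContinuous h
  have hcons : Conservative T (densityMeasure h) :=
    conservative_of_frequently_visits hB5.measurePreserving
      (measurable_subtype_coe measurableSet_Icc) (hB5.densityMeasure_Icc_ne_top hsys.a_pos)
      (hac.ae_le (hsys.ae_frequently_mem_Icc hT))
  have hexact := hsys.isExactMap hT
  exact ⟨⟨hcons.of_absolutelyContinuous hB5.lebHalfLine_absolutelyContinuous hT, hexact⟩,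
    hcons, fun s hs => (hexact s hs).imp (fun h0 => hac h0) (fun h0 => hac h0)⟩
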